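/- For every $p>0$ there are constants $c>0$ and $n_0$ such that the following holds for every finite field $\mathbb{F}_q$ and every $n\ge n_0$. Consider a randomized classical algorithm that is given a vector $b\in\mathbb{F}_q^n$ and has access to an unknown invertible matrix $A\in\mathbb{F}_q^{n\times n}$ only through (adaptively chosen) vector-matrix-vector (vmv) queries: on vectors $x,y\in\mathbb{F}_q^n$, a query returns $y^{\top}\!A x$. Suppose that for every invertible $A$ and every $b$ the algorithm makes at most $t$ queries and outputs, with probability at least $p$, the vector $x$ with $Ax=b$. Then $t\ge c\,n^2$. In particular (taking $p=2/3$), the bounded-error classical vmv query complexity of solving an $n\times n$ linear system over $\mathbb{F}_q$ is $\Omega(n^2)$, even when the system is promised to be invertible. -/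

import Mathlib

/-- A deterministic adaptive classical algorithm with vector-matrix-vector query access to a hidden
`n × n` matrix `M` over `F`, with outputs in `α`: a decision tree each of whose inner nodes asks for
`yᵀ M x` for two vectors `y`, `x` and branches on the answer. -/
inductive VMVTree (F : Type*) (n : ℕ) (α : Type*) where
  /-- Stop and return `a`. -/
  | output (a : α) : VMVTree F n α
  /-- Query `yᵀ M x`, and continue with `next r`, where `r` is the answer. -/
  | query (y x : Fin n → F) (next : F → VMVTree F n α) : VMVTree F n α

namespace VMVTree

variable {F : Type*} [Field F] {n : ℕ} {α : Type*}

/-- The output of the algorithm when the hidden matrix is `M`. -/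
def run (M : Matrix (Fin n) (Fin n) F) : VMVTree F n α → α
  | output a => a
  | query y x next => run M (next (y ⬝ᵥ M.mulVec x))

/-- The number of queries that the algorithm makes when the hidden matrix is `M`. -/
def numQueries (M : Matrix (Fin n) (Fin n) F) : VMVTree F n α → ℕ
  | output _ => 0
  | query y x next => numQueries M (next (y ⬝ᵥ M.mulVec x)) + 1

end VMVTree

/-- A randomized classical algorithm with vmv query access: a probability distribution over
deterministic ones. -/
abbrev RandVMVAlg (F : Type*) (n : ℕ) (α : Type*) := PMF (VMVTree F n α)

/-- A randomized classical algorithm for `n × n` linear systems `A x = b`, which knows `b` and has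
vmv query access to `A`. It solves linear systems with success probability `p` and at most `t`
queries if, for every invertible `A` and every `b`, it never makes more than `t` queries, and its
output is the solution of `A x = b` with probability at least `p`. -/
def SolvesLinearSystems {F : Type*} [Field F] {n : ℕ}
    (alg : (Fin n → F) → RandVMVAlg F n (Fin n → F)) (p : ℝ) (t : ℕ) : Prop :=
  ∀ (A : Matrix (Fin n) (Fin n) F) (b : Fin n → F), IsUnit A →
    (∀ T ∈ (alg b).support, T.numQueries A ≤ t) ∧
    ENNReal.ofReal p ≤ (alg b).toOuterMeasure {T | A.mulVec (T.run A) = b}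

open Module Finset

namespace VMVTree

variable {F : Type*} [Field F] {n : ℕ}

/-- Evaluation of matrices at a fixed vector, as a linear map. -/
def evalAt (x : Fin n → F) : Matrix (Fin n) (Fin n) F →ₗ[F] (Fin n → F) where
  toFun B := B.mulVec x
  map_add' A B := Matrix.add_mulVec A B x
  map_smul' c B := Matrix.smul_mulVec c B x

@[simp] lemma evalAt_apply (x : Fin n → F) (B : Matrix (Fin n) (Fin n) F) :
    evalAt x B = B.mulVec x := rfl

/-- The linear functional on matrices computed by a vector-matrix-vector query. -/
def queryFun (y x : Fin n → F) : Matrix (Fin n) (Fin n) F →ₗ[F] F where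
  toFun B := y ⬝ᵥ B.mulVec x
  map_add' A B := by rw [Matrix.add_mulVec, dotProduct_add]
  map_smul' c B := by rw [Matrix.smul_mulVec, dotProduct_smul]; rfl

@[simp] lemma queryFun_apply (y x : Fin n → F) (B : Matrix (Fin n) (Fin n) F) :
    queryFun y x B = y ⬝ᵥ B.mulVec x := rfl

/-- The vectors at which the matrices of `W` take at most `q ^ h` values. -/
def lowRankAt (W : Submodule F (Matrix (Fin n) (Fin n) F)) (h : ℕ) : Set (Fin n → F) :=
  {x | finrank F (W.map (evalAt x)) ≤ h}

lemma lowRankAt_anti {W W' : Submodule F (Matrix (Fin n) (Fin n) F)} (hW : W' ≤ W) (h : ℕ) :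
    lowRankAt W h ⊆ lowRankAt W' h := fun _ hx =>
  (Submodule.finrank_mono (Submodule.map_mono hW)).trans hx

lemma finrank_le_finrank_inf_ker_add_one {V : Type*} [AddCommGroup V] [Module F V]
    [FiniteDimensional F V] (W : Submodule F V) (f : V →ₗ[F] F) :
    finrank F W ≤ finrank F (W ⊓ LinearMap.ker f : Submodule F V) + 1 := by
  have h1 := Submodule.finrank_sup_add_finrank_inf_eq W (LinearMap.ker f)
  have h2 := LinearMap.finrank_range_add_finrank_ker f
  have h3 : finrank F (LinearMap.range f) ≤ 1 :=
    (Submodule.finrank_le _).trans (by simp)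
  have h4 := Submodule.finrank_le (W ⊔ LinearMap.ker f)
  omega

lemma finrank_le_finrank_map_add_finrank_ker {V U : Type*} [AddCommGroup V] [Module F V]
    [FiniteDimensional F V] [AddCommGroup U] [Module F U] (W : Submodule F V) (f : V →ₗ[F] U) :
    finrank F W ≤ finrank F (W.map f) + finrank F (LinearMap.ker f) := by
  have h1 := LinearMap.finrank_range_add_finrank_ker (f.domRestrict W)
  have h2 : LinearMap.range (f.domRestrict W) = W.map f := LinearMap.range_domRestrict _ _
  have h3 : finrank F (LinearMap.ker (f.domRestrict W)) ≤ finrank F (LinearMap.ker f) := by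
    refine LinearMap.finrank_le_finrank_of_injective
      (f := (W.subtype.restrict (p := LinearMap.ker (f.domRestrict W)) (q := LinearMap.ker f)
        (fun _ hx => hx))) ?_
    intro a b hab
    have hab' := congrArg Subtype.val hab
    exact Subtype.ext (Subtype.ext hab')
  rw [h2] at h1
  omega

/-- Simultaneous evaluation of matrices at a linearly independent family is surjective. -/
lemma surjective_pi_evalAt {m : ℕ} {v : Fin m → Fin n → F} (hv : LinearIndependent F v) :
    Function.Surjective (LinearMap.pi fun i => evalAt (v i)) := by
  intro w
  obtain ⟨g, hg⟩ := ((Basis.span hv).constr F w).exists_extend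
  refine ⟨LinearMap.toMatrix' g, funext fun i => ?_⟩
  have h1 := LinearMap.congr_fun hg (Basis.span hv i)
  rw [Basis.constr_basis, LinearMap.comp_apply, Submodule.subtype_apply,
    Basis.span_apply] at h1
  simpa [LinearMap.toMatrix'_mulVec] using h1

/-- If `W` has codimension at most `t`, a linearly independent family in `lowRankAt W h` with
`2 h ≤ n` has size `m` with `m n ≤ 2 t`. -/
lemma card_mul_le_of_mem_lowRankAt {m h t : ℕ} {v : Fin m → Fin n → F}
    (hv : LinearIndependent F v) {W : Submodule F (Matrix (Fin n) (Fin n) F)}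
    (hW : n * n ≤ finrank F W + t) (hh : 2 * h ≤ n) (hm : ∀ i, v i ∈ lowRankAt W h) :
    m * n ≤ 2 * t := by
  set L : Matrix (Fin n) (Fin n) F →ₗ[F] (Fin m → Fin n → F) :=
    LinearMap.pi fun i => evalAt (v i) with hL
  have h1 := finrank_le_finrank_map_add_finrank_ker W L
  have h2 := LinearMap.finrank_range_add_finrank_ker L
  rw [LinearMap.range_eq_top.2 (surjective_pi_evalAt hv), finrank_top, finrank_matrix] at h2
  simp only [finrank_pi_fintype, Finset.sum_const, Finset.card_univ, Fintype.card_fin,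
    finrank_self, smul_eq_mul, mul_one] at h2
  have h3 : finrank F (W.map L) ≤ m * h := by
    let g : (W.map L) →ₗ[F] ((i : Fin m) → W.map (evalAt (v i))) :=
      LinearMap.pi fun i => (LinearMap.proj i).restrict (p := W.map L)
        (q := W.map (evalAt (v i))) (by
          rintro _ ⟨B, hB, rfl⟩
          exact ⟨B, hB, rfl⟩)
    have hg : Function.Injective g := by
      intro a b hab
      refine Subtype.ext (funext fun i => ?_)
      exact congrArg Subtype.val (congrFun hab i)
    refine (LinearMap.finrank_le_finrank_of_injective hg).trans ?_
    rw [finrank_pi_fintype]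
    calc _ ≤ ∑ _i : Fin m, h := Finset.sum_le_sum fun i _ => hm i
      _ = m * h := by simp
  nlinarith

/-- The vectors at which a space of small codimension has low rank are few. -/
lemma ncard_lowRankAt_le [Finite F] {h t k : ℕ}
    {W : Submodule F (Matrix (Fin n) (Fin n) F)}
    (hW : n * n ≤ finrank F W + t) (hh : 2 * h ≤ n) (hk : 2 * t < (k + 1) * n) :
    (lowRankAt W h).ncard ≤ Nat.card F ^ k := by
  set X := Submodule.span F (lowRankAt W h)
  obtain ⟨v, hv, -, hli⟩ := Submodule.exists_fun_fin_finrank_span_eq F (lowRankAt W h)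
  have h1 := card_mul_le_of_mem_lowRankAt hli hW hh hv
  have h2 : finrank F X ≤ k := by
    by_contra! hc
    have := Nat.mul_le_mul_right n (Nat.succ_le_of_lt hc)
    exact absurd (this.trans h1) (not_le.2 hk)
  calc (lowRankAt W h).ncard ≤ (X : Set (Fin n → F)).ncard :=
        Set.ncard_le_ncard Submodule.subset_span (Set.toFinite _)
    _ = Nat.card F ^ finrank F X := Module.natCard_eq_pow_finrank
    _ ≤ _ := Nat.pow_le_pow_right Nat.card_pos h2

lemma lowRankAt_top {h : ℕ} (hh : h < n) :
    lowRankAt (⊤ : Submodule F (Matrix (Fin n) (Fin n) F)) h ⊆ {0} := by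
  intro x hx
  by_contra hx0
  have hsurj : Function.Surjective (evalAt x) := by
    have hli : LinearIndependent F (fun _ : Fin 1 => x) :=
      LinearIndependent.of_subsingleton 0 hx0
    intro w
    obtain ⟨B, hB⟩ := surjective_pi_evalAt hli (fun _ => w)
    exact ⟨B, congrFun hB 0⟩
  have : finrank F ((⊤ : Submodule F (Matrix (Fin n) (Fin n) F)).map (evalAt x)) ≤ h := hx
  rw [Submodule.map_top, LinearMap.range_eq_top.2 hsurj, finrank_top] at this
  simp at this
  omega

open Classical in
/-- In a coset of `W`, at most a `q ^ -(h + 1)` fraction of the matrices map a vector outside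
`lowRankAt W h` to a prescribed value. -/
lemma card_filter_mulVec_eq_mul_le [Fintype F] {W : Submodule F (Matrix (Fin n) (Fin n) F)}
    {V : Finset (Matrix (Fin n) (Fin n) F)} (hV : ∀ A ∈ V, ∀ B, B ∈ V ↔ B - A ∈ W)
    {h : ℕ} {x b : Fin n → F} (hx : x ∉ lowRankAt W h) :
    #{A ∈ V | A.mulVec x = b} * Fintype.card F ^ (h + 1) ≤ #V := by
  by_cases he : ∃ A ∈ V, A.mulVec x = b
  · obtain ⟨A, hA, hAx⟩ := he
    have h1 : #V = Nat.card W := by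
      rw [← Nat.card_eq_finsetCard]
      refine Nat.card_congr ⟨fun B => ⟨B - A, (hV A hA B).1 B.2⟩,
        fun B => ⟨B + A, (hV A hA _).2 (by simp)⟩, fun B => by simp, fun B => by simp⟩
    have h2 : #{A ∈ V | A.mulVec x = b} = Nat.card (LinearMap.ker ((evalAt x).domRestrict W)) := by
      rw [← Nat.card_eq_finsetCard]
      refine Nat.card_congr ⟨fun B => ⟨⟨B - A, (hV A hA B).1 (Finset.mem_filter.1 B.2).1⟩, ?_⟩,
        fun B => ⟨B.1 + A, Finset.mem_filter.2 ⟨(hV A hA _).2 (by simp), ?_⟩⟩,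
        fun B => by simp, fun B => by simp⟩
      · have := (Finset.mem_filter.1 B.2).2
        simp [Matrix.sub_mulVec, this, hAx]
      · have := B.2
        simp only [LinearMap.mem_ker, LinearMap.domRestrict_apply, evalAt_apply] at this
        rw [Matrix.add_mulVec, this, hAx, zero_add]
    have h3 := LinearMap.finrank_range_add_finrank_ker ((evalAt x).domRestrict W)
    rw [LinearMap.range_domRestrict] at h3
    have h4 : h < finrank F (W.map (evalAt x)) := not_le.1 hx
    rw [h1, h2, Module.natCard_eq_pow_finrank (K := F) (V := W),
      Module.natCard_eq_pow_finrank (K := F)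
        (V := LinearMap.ker ((evalAt x).domRestrict W)),
      Nat.card_eq_fintype_card, ← pow_add]
    exact Nat.pow_le_pow_right Fintype.card_pos (by omega)
  · rw [Finset.filter_false_of_mem fun A hA hx => he ⟨A, hA, hx⟩]
    simp

open Classical in
/-- Bound on the number of matrices, in a coset of `W`, on which a tree finds the solution of a
linear system with at most `t` queries. -/
lemma card_success_mul_le [Fintype F] (b : Fin n → F) (h t₀ M : ℕ)
    (hM : ∀ W : Submodule F (Matrix (Fin n) (Fin n) F), n * n ≤ finrank F W + t₀ →
      (lowRankAt W h).ncard ≤ M)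
    (T : VMVTree F n (Fin n → F)) :
    ∀ (t : ℕ) (W : Submodule F (Matrix (Fin n) (Fin n) F))
      (V : Finset (Matrix (Fin n) (Fin n) F)), (∀ A ∈ V, ∀ B, B ∈ V ↔ B - A ∈ W) →
      n * n + t ≤ finrank F W + t₀ →
      #{A ∈ V | T.numQueries A ≤ t ∧ A.mulVec (T.run A) = b} * Fintype.card F ^ (h + 1) ≤
        (∑ x with x ∈ lowRankAt W h, #{A ∈ V | A.mulVec x = b}) * Fintype.card F ^ (h + 1) +
          (1 + t * M) * #V := by
  induction T with
  | output a =>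
    intro t W V hV _
    simp only [numQueries, run, zero_le, true_and]
    by_cases ha : a ∈ lowRankAt W h
    · refine le_add_right (Nat.mul_le_mul_right _ ?_)
      exact Finset.single_le_sum (f := fun x => #{A ∈ V | A.mulVec x = b})
        (fun _ _ => Nat.zero_le _) (Finset.mem_filter.2 ⟨Finset.mem_univ _, ha⟩)
    · refine le_add_left ((card_filter_mulVec_eq_mul_le hV ha).trans ?_)
      exact Nat.le_mul_of_pos_left _ (by omega)
  | query y x next ih =>
    intro t W V hV hW
    cases t with
    | zero => simp [numQueries]
    | succ t =>
      set W' := W ⊓ LinearMap.ker (queryFun y x)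
      set Q := Fintype.card F ^ (h + 1)
      have hW' : n * n + t ≤ finrank F W' + t₀ := by
        have : finrank F W ≤ finrank F W' + 1 :=
          finrank_le_finrank_inf_ker_add_one W (queryFun y x)
        omega
      set V' : F → Finset (Matrix (Fin n) (Fin n) F) :=
        fun r => {A ∈ V | y ⬝ᵥ A.mulVec x = r} with hV'
      have hV'c : ∀ r, ∀ A ∈ V' r, ∀ B, B ∈ V' r ↔ B - A ∈ W' := by
        intro r A hA B
        obtain ⟨hA', rfl⟩ := Finset.mem_filter.1 hA
        simp only [hV', Finset.mem_filter, hV A hA' B, W', Submodule.mem_inf, LinearMap.mem_ker,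
          map_sub, queryFun_apply, sub_eq_zero]
      have hsplit : ∀ (P : Matrix (Fin n) (Fin n) F → Prop) [DecidablePred P],
          #{A ∈ V | P A} = ∑ r, #{A ∈ V' r | P A} := by
        intro P _
        rw [Finset.card_eq_sum_card_fiberwise (f := fun A => y ⬝ᵥ A.mulVec x)
          (t := Finset.univ) (fun _ _ => by simp)]
        refine Finset.sum_congr rfl fun r _ => ?_
        rw [hV', Finset.filter_comm]
      have hVsum : #V = ∑ r, #(V' r) := by
        have := hsplit fun _ => True
        simpa using this
      have hN : #{A ∈ V | (query y x next).numQueries A ≤ t + 1 ∧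
            A.mulVec ((query y x next).run A) = b} =
          ∑ r, #{A ∈ V' r | (next r).numQueries A ≤ t ∧ A.mulVec ((next r).run A) = b} := by
        rw [hsplit]
        refine Finset.sum_congr rfl fun r _ => congrArg _ (Finset.filter_congr fun A hA => ?_)
        obtain ⟨-, rfl⟩ := Finset.mem_filter.1 hA
        simp [numQueries, run]
      have hnew : (∑ x with x ∈ lowRankAt W' h, #{A ∈ V | A.mulVec x = b}) * Q ≤
          (∑ x with x ∈ lowRankAt W h, #{A ∈ V | A.mulVec x = b}) * Q + M * #V := by
        have hsub : ({x | x ∈ lowRankAt W h} : Finset (Fin n → F)) ⊆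
            ({x | x ∈ lowRankAt W' h} : Finset (Fin n → F)) := fun x hx => by
          simp only [Finset.mem_filter, Finset.mem_univ, true_and] at hx ⊢
          exact lowRankAt_anti inf_le_left h hx
        rw [← Finset.sum_sdiff hsub, add_mul, add_comm]
        refine Nat.add_le_add_left ?_ _
        rw [Finset.sum_mul]
        calc _ ≤ ∑ _x ∈ ({x | x ∈ lowRankAt W' h} : Finset (Fin n → F)) \
                ({x | x ∈ lowRankAt W h} : Finset (Fin n → F)), #V :=
              Finset.sum_le_sum fun x hx => card_filter_mulVec_eq_mul_le hV (by
                simpa using (Finset.mem_sdiff.1 hx).2)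
          _ ≤ M * #V := by
            rw [Finset.sum_const, smul_eq_mul]
            refine Nat.mul_le_mul_right _ ((Finset.card_le_card Finset.sdiff_subset).trans ?_)
            have := hM W' (by omega)
            rwa [← Set.ncard_coe_finset, Finset.coe_filter_univ]
      rw [hN, Finset.sum_mul]
      calc _ ≤ ∑ r, ((∑ x with x ∈ lowRankAt W' h, #{A ∈ V' r | A.mulVec x = b}) * Q +
              (1 + t * M) * #(V' r)) :=
            Finset.sum_le_sum fun r _ => ih r t W' (V' r) (hV'c r) hW'
        _ = (∑ x with x ∈ lowRankAt W' h, #{A ∈ V | A.mulVec x = b}) * Q +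
              (1 + t * M) * #V := by
            rw [Finset.sum_add_distrib, ← Finset.sum_mul, ← Finset.mul_sum, ← hVsum,
              Finset.sum_comm]
            exact congrArg (· * Q + _) (Finset.sum_congr rfl fun z _ => (hsplit _).symm)
        _ ≤ _ := by
            have : (1 + (t + 1) * M) * #V = M * #V + (1 + t * M) * #V := by ring
            rw [this, ← add_assoc]
            exact Nat.add_le_add_right hnew _

open Classical in
/-- A tree solves `A x = b`, `b ≠ 0`, with at most `t` queries only for few matrices `A`. -/
lemma card_solved_mul_le [Fintype F] {b : Fin n → F} (hb : b ≠ 0) (hn : 0 < n) {t k : ℕ}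
    (hk : 2 * t < (k + 1) * n) (T : VMVTree F n (Fin n → F)) :
    #{A : Matrix (Fin n) (Fin n) F | T.numQueries A ≤ t ∧ A.mulVec (T.run A) = b} *
        Fintype.card F ^ (n / 2 + 1) ≤
      (1 + t * Fintype.card F ^ k) * Fintype.card F ^ (n * n) := by
  have key := card_success_mul_le b (n / 2) t (Fintype.card F ^ k)
    (fun W hW => by
      rw [← Nat.card_eq_fintype_card]
      exact ncard_lowRankAt_le hW (by omega) hk) T t ⊤ Finset.univ (by simp)
    (by simp [finrank_matrix])
  have h0 : (∑ x with x ∈ lowRankAt (⊤ : Submodule F (Matrix (Fin n) (Fin n) F)) (n / 2),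
      #{A : Matrix (Fin n) (Fin n) F | A.mulVec x = b}) = 0 := by
    refine Finset.sum_eq_zero fun x hx => ?_
    have : x = 0 := lowRankAt_top (by omega) (Finset.mem_filter.1 hx).2
    simp [this, hb.symm]
  have hc : #(Finset.univ : Finset (Matrix (Fin n) (Fin n) F)) = Fintype.card F ^ (n * n) := by
    rw [Finset.card_univ, ← Nat.card_eq_fintype_card,
      Module.natCard_eq_pow_finrank (K := F), finrank_matrix]
    simp
  rwa [h0, zero_mul, zero_add, hc] at key

lemma quarter_le_prod_one_sub (q : ℝ) (hq : 2 ≤ q) (n : ℕ) :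
    1 / 4 ≤ ∏ i ∈ Finset.range n, (1 - 1 / q ^ (i + 1)) := by
  have key : ∀ n : ℕ, 1 / 4 + (1 / 2 : ℝ) ^ (n + 2) ≤
      ∏ i ∈ Finset.range (n + 1), (1 - (1 / 2 : ℝ) ^ (i + 1)) := by
    intro n
    induction n with
    | zero => norm_num
    | succ n ih =>
      rw [Finset.prod_range_succ]
      have h1 : (0 : ℝ) < (1 / 2) ^ n := by positivity
      have h2 : (1 / 2 : ℝ) ^ n ≤ 1 := pow_le_one₀ (by norm_num) (by norm_num)
      have h3 : (0 : ℝ) ≤ 1 - (1 / 2) ^ (n + 1 + 1) := by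
        rw [pow_succ, pow_succ]; linarith
      refine le_trans ?_ (mul_le_mul_of_nonneg_right ih h3)
      simp only [pow_succ]
      nlinarith
  have hmono : ∏ i ∈ Finset.range n, (1 - (1 / 2 : ℝ) ^ (i + 1)) ≤
      ∏ i ∈ Finset.range n, (1 - 1 / q ^ (i + 1)) := by
    refine Finset.prod_le_prod (fun i _ => sub_nonneg.2 (pow_le_one₀ (by norm_num) (by norm_num)))
      fun i _ => ?_
    rw [one_div_pow]
    gcongr
  refine le_trans ?_ hmono
  cases n with
  | zero => norm_num
  | succ n =>
    have : (0 : ℝ) ≤ (1 / 2) ^ (n + 2) := by positivity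
    linarith [key n]

/-- At least a quarter of the matrices over a finite field are invertible. -/
lemma pow_le_four_mul_card_isUnit [Fintype F] (n : ℕ)
    [DecidablePred fun A : Matrix (Fin n) (Fin n) F => IsUnit A] :
    (Fintype.card F : ℝ) ^ (n * n) ≤ 4 * #{A : Matrix (Fin n) (Fin n) F | IsUnit A} := by
  have h1 : #{A : Matrix (Fin n) (Fin n) F | IsUnit A} = ∏ i : Fin n,
      (Fintype.card F ^ n - Fintype.card F ^ (i : ℕ)) := by
    rw [← Matrix.card_GL_field, ← Nat.card_eq_finsetCard]
    refine Nat.card_congr ⟨fun A => (Finset.mem_filter.1 A.2).2.unit,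
      fun A => ⟨A, by simp⟩, fun A => by simp, fun A => by ext; simp⟩
  have hq : (2 : ℝ) ≤ Fintype.card F := by exact_mod_cast Fintype.one_lt_card (α := F)
  have hq0 : (0 : ℝ) < Fintype.card F := by linarith
  have h2 : ((∏ i : Fin n, (Fintype.card F ^ n - Fintype.card F ^ (i : ℕ)) : ℕ) : ℝ) =
      (Fintype.card F : ℝ) ^ (n * n) *
        ∏ i ∈ Finset.range n, (1 - 1 / (Fintype.card F : ℝ) ^ (i + 1)) := by
    have h3 : (Fintype.card F : ℝ) ^ (n * n) =
        ∏ _i ∈ Finset.range n, (Fintype.card F : ℝ) ^ n := by simp [pow_mul]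
    rw [← Finset.prod_range_reflect, h3, ← Finset.prod_mul_distrib,
      Fin.prod_univ_eq_prod_range (fun i => Fintype.card F ^ n - Fintype.card F ^ i) n,
      Nat.cast_prod]
    refine Finset.prod_congr rfl fun i hi => ?_
    have hi := Finset.mem_range.1 hi
    rw [Nat.cast_sub (Nat.pow_le_pow_right Fintype.card_pos hi.le), Nat.cast_pow, Nat.cast_pow]
    have e : n = i + (n - 1 - i + 1) := by omega
    have e2 : (Fintype.card F : ℝ) ^ n = Fintype.card F ^ i * Fintype.card F ^ (n - 1 - i + 1) := by
      rw [← pow_add, ← e]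
    rw [e2]
    field_simp
  rw [h1, h2]
  have := quarter_le_prod_one_sub _ hq n
  nlinarith [pow_pos hq0 (n * n)]

end VMVTree

open Classical in
/-- Averaging over the invertible matrices: if each of the deterministic algorithms solves the
system for at most `K` matrices, then so does the randomized one on average. -/
lemma SolvesLinearSystems.mul_card_isUnit_le {F : Type*} [Field F] [Fintype F] {n : ℕ}
    {alg : (Fin n → F) → RandVMVAlg F n (Fin n → F)} {p : ℝ} {t : ℕ}
    (hp : 0 ≤ p) (hs : SolvesLinearSystems alg p t) (b : Fin n → F) (K : ℕ)
    (hK : ∀ T : VMVTree F n (Fin n → F),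
      #{A : Matrix (Fin n) (Fin n) F | T.numQueries A ≤ t ∧ A.mulVec (T.run A) = b} ≤ K) :
    p * #{A : Matrix (Fin n) (Fin n) F | IsUnit A} ≤ K := by
  set G : Finset (Matrix (Fin n) (Fin n) F) := {A | IsUnit A}
  have hmain : (#G : ENNReal) * ENNReal.ofReal p ≤ K := by
    calc (#G : ENNReal) * ENNReal.ofReal p = ∑ _A ∈ G, ENNReal.ofReal p := by simp
      _ ≤ ∑ A ∈ G, ∑' T, {T : VMVTree F n (Fin n → F) | A.mulVec (T.run A) = b}.indicator
            (alg b) T := by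
          refine Finset.sum_le_sum fun A hA => ?_
          have := (hs A b (Finset.mem_filter.1 hA).2).2
          rwa [PMF.toOuterMeasure_apply] at this
      _ = ∑' T, ∑ A ∈ G, {T : VMVTree F n (Fin n → F) | A.mulVec (T.run A) = b}.indicator
            (alg b) T := (Summable.tsum_finsetSum fun _ _ => ENNReal.summable).symm
      _ ≤ ∑' T, alg b T * K := by
          refine ENNReal.tsum_le_tsum fun T => ?_
          by_cases hT : T ∈ (alg b).support
          · simp only [Set.indicator_apply, Set.mem_ofPred_eq]
            rw [← Finset.sum_filter, Finset.sum_const, nsmul_eq_mul, mul_comm]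
            gcongr
            refine (Finset.card_le_card fun A hA => ?_).trans (hK T)
            obtain ⟨hA, hAb⟩ := Finset.mem_filter.1 hA
            simp only [Finset.mem_filter, Finset.mem_univ, true_and]
            exact ⟨(hs A b (Finset.mem_filter.1 hA).2).1 T hT, hAb⟩
          · have : alg b T = 0 := by simpa [PMF.mem_support_iff] using hT
            simp [Set.indicator_apply, this]
      _ = K := by rw [ENNReal.tsum_mul_right, PMF.tsum_coe, one_mul]
  have := ENNReal.toReal_mono (by simp) hmain
  simpa [ENNReal.toReal_ofReal hp, mul_comm] using this

lemma eventually_mul_pow_lt {p : ℝ} (hp : 0 < p) :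
    ∀ᶠ n : ℕ in Filter.atTop, 4 * (1 + (n : ℝ) ^ 2) < p * 8 ^ (n / 8) := by
  have h1 : Filter.Tendsto (fun k : ℕ => (k : ℝ) ^ 2 * (1 / 8) ^ k) Filter.atTop (nhds 0) :=
    tendsto_pow_const_mul_const_pow_of_lt_one 2 (by norm_num) (by norm_num)
  have h2 := h1.eventually (gt_mem_nhds (show (0 : ℝ) < p / 1028 by positivity))
  have hdiv : Filter.Tendsto (fun n : ℕ => n / 8) Filter.atTop Filter.atTop :=
    Nat.tendsto_div_const_atTop (by norm_num)
  filter_upwards [hdiv.eventually h2, hdiv.eventually (Filter.eventually_ge_atTop 1)] with n hn hk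
  have hk : (1 : ℝ) ≤ (n / 8 : ℕ) := by exact_mod_cast hk
  have hle : (n : ℝ) ≤ 8 * (n / 8 : ℕ) + 8 := by
    have : n ≤ 8 * (n / 8) + 8 := by omega
    exact_mod_cast this
  generalize n / 8 = k at *
  rw [one_div_pow, mul_one_div, div_lt_iff₀ (by positivity)] at hn
  have : (n : ℝ) ^ 2 ≤ (16 * k) ^ 2 := by gcongr; linarith
  nlinarith

theorem mainTheorem10 (p : ℝ) (hp : 0 < p) :
    ∃ c : ℝ, 0 < c ∧ ∃ n₀ : ℕ, ∀ (F : Type*) [Field F] [Finite F] (n : ℕ), n₀ ≤ n →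
      ∀ (alg : (Fin n → F) → RandVMVAlg F n (Fin n → F)) (t : ℕ),
        SolvesLinearSystems alg p t → c * (n : ℝ) ^ 2 ≤ (t : ℝ) := by
  obtain ⟨n₀, hn₀⟩ := Filter.eventually_atTop.1 (eventually_mul_pow_lt hp)
  refine ⟨1 / 16, by norm_num, max n₀ 1, ?_⟩
  intro F _ _ n hn alg t hs
  classical
  have := Fintype.ofFinite F
  have hn1 : 0 < n := (le_max_right n₀ 1).trans hn
  have hnp := hn₀ n ((le_max_left n₀ 1).trans hn)
  by_contra! hlt
  have hlt' : 16 * t < n ^ 2 := by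
    have : 16 * (t : ℝ) < (n : ℝ) ^ 2 := by linarith
    exact_mod_cast this
  have hb : (fun _ => 1 : Fin n → F) ≠ 0 := fun h => one_ne_zero (congrFun h ⟨0, hn1⟩)
  set q := Fintype.card F
  have hq : 2 ≤ q := Fintype.one_lt_card
  set k := n / 8
  have hk : 2 * t < (k + 1) * n := by
    have : n ≤ 8 * (k + 1) := by omega
    nlinarith
  set K := ((1 + t * q ^ k) * q ^ (n * n)) / q ^ (n / 2 + 1)
  have hK := hs.mul_card_isUnit_le hp.le (fun _ => 1) K fun T =>
    (Nat.le_div_iff_mul_le (by positivity)).2 (VMVTree.card_solved_mul_le hb hn1 hk T)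
  have hG := VMVTree.pow_le_four_mul_card_isUnit (F := F) n
  have hq1 : (1 : ℝ) ≤ q := by exact_mod_cast (by omega : 1 ≤ q)
  have hN : (0 : ℝ) < (q : ℝ) ^ (n * n) := by positivity
  have hKle : (K : ℝ) * q ^ (4 * k) ≤ (1 + n ^ 2) * q ^ k * q ^ (n * n) := by
    have h1 : K * q ^ (4 * k) ≤ (1 + t * q ^ k) * q ^ (n * n) :=
      (Nat.mul_le_mul_left _ (Nat.pow_le_pow_right (by omega) (by omega))).trans
        (Nat.div_mul_le_self _ _)
    have h2 : 1 + t * q ^ k ≤ (1 + n ^ 2) * q ^ k := by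
      have : 1 ≤ q ^ k := Nat.one_le_pow _ _ (by omega)
      nlinarith
    exact_mod_cast h1.trans (Nat.mul_le_mul_right _ h2)
  have h3 : p * (q : ℝ) ^ (n * n) * q ^ (4 * k) ≤ 4 * ((1 + n ^ 2) * q ^ k * q ^ (n * n)) := by
    calc p * (q : ℝ) ^ (n * n) * q ^ (4 * k) ≤ 4 * K * q ^ (4 * k) := by
          refine mul_le_mul_of_nonneg_right ?_ (by positivity)
          calc p * (q : ℝ) ^ (n * n) ≤ p * (4 * #{A : Matrix (Fin n) (Fin n) F | IsUnit A}) :=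
                mul_le_mul_of_nonneg_left hG hp.le
            _ ≤ 4 * K := by linarith
      _ ≤ _ := by linarith
  have h4 : p * (q : ℝ) ^ (3 * k) ≤ 4 * (1 + n ^ 2) := by
    have hpos : (0 : ℝ) < q ^ (n * n) * q ^ k := by positivity
    refine le_of_mul_le_mul_right ?_ hpos
    rw [show 4 * k = 3 * k + k by ring, pow_add] at h3
    linarith
  have h5 : (8 : ℝ) ^ k ≤ q ^ (3 * k) := by
    rw [pow_mul]
    gcongr
    have : (2 : ℝ) ≤ q := by exact_mod_cast hq
    calc (8 : ℝ) = 2 ^ 3 := by norm_num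
      _ ≤ _ := by gcongr
  nlinarith
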